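/- A metric space $(X,d)$ has \emph{property A} if for all $R,\epsilon>0$ there exist finite, non-empty subsets $A_x\subseteq X\times\mathbb{N}$ ($x\in X$) and a number $S$ such that $|A_x\triangle A_y|/|A_x\cap A_y|<\epsilon$ whenever $d(x,y)\le R$ (in particular $A_x\cap A_y\ne\emptyset$ for such $x,y$), and $d(x,y)\le S$ whenever $(y,n)\in A_x$. A metric space has \emph{bounded geometry} if for every $r>0$ there is $N_r\in\mathbb{N}$ such that every open ball of radius $r$ has fewer than $N_r$ points. A countable discrete group has \emph{property A} if it has property A as a metric space when it is equipped with a left-invariant metric of bounded geometry; such a metric always exists, and the choice of the metric does not matter. \textbf{Theorem.} Let $G$ and $H$ be countable discrete groups with property A, and let $K$ be a common subgroup of $G$ and $H$ (that is, $K$ is a group together with injective homomorphisms $K\to G$ and $K\to H$). Then the amalgamated free product $F=G\ast_K H$ has property A. -/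

import Mathlib

universe u v

open Classical in
/-- Property A of a metric space `X`: for all `R, ε > 0` there are finite non-empty sets
`A x ⊆ X × ℕ` (`x : X`) with `|A x ∆ A y| / |A x ∩ A y| < ε` whenever `d(x, y) ≤ R`, such that
`A x` lies over a ball around `x` of a radius `S` that does not depend on `x`.
The quotient is written in multiplied-out form, so that it is never `< ε` when
`A x ∩ A y` is empty. -/
def HasPropertyA (X : Type*) [MetricSpace X] : Prop :=
  ∀ R ε : ℝ, 0 < R → 0 < ε → ∃ A : X → Finset (X × ℕ),
    (∀ x, (A x).Nonempty) ∧
    (∀ x y, dist x y ≤ R →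
      ((symmDiff (A x) (A y)).card : ℝ) < ε * ((A x ∩ A y).card : ℝ)) ∧
    ∃ S : ℝ, ∀ x y : X, ∀ n : ℕ, (y, n) ∈ A x → dist x y ≤ S

/-- Bounded geometry: for each radius there is a uniform finite bound on the number of points
of a ball of that radius. (Such a metric space is automatically discrete and countable.) -/
def HasBoundedGeometry (X : Type*) [MetricSpace X] : Prop :=
  ∀ r : ℝ, 0 < r → ∃ N : ℕ, ∀ x : X, (Metric.ball x r).encard < (N : ℕ∞)

/-- A group `G` has property A if it has property A for a left-invariant metric of bounded
geometry. (`IsIsometricSMul G G`: left translations are isometries.) A group carries such a metric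
iff it is countable, and the choice of the metric does not matter, see
`GroupHasPropertyA.hasPropertyA`. -/
def GroupHasPropertyA (G : Type*) [Group G] : Prop :=
  ∃ _ : MetricSpace G, IsIsometricSMul G G ∧ HasBoundedGeometry G ∧ HasPropertyA G

/-- Between two left-invariant metrics on a group, the first of bounded geometry, the identity
is bornologous. -/
theorem exists_dist_le_of_boundedGeometry {G : Type*} [Group G] (m₁ m₂ : MetricSpace G)
    (h₁ : @IsIsometricSMul G G m₁.toPseudoMetricSpace.toPseudoEMetricSpace _)
    (b₁ : @HasBoundedGeometry G m₁)
    (h₂ : @IsIsometricSMul G G m₂.toPseudoMetricSpace.toPseudoEMetricSpace _) (R : ℝ) :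
    ∃ S : ℝ, ∀ x y : G, m₁.dist x y ≤ R → m₂.dist x y ≤ S := by
  obtain ⟨N, hN⟩ := b₁ (max R 0 + 1) (by positivity)
  have hfin : (@Metric.ball G m₁.toPseudoMetricSpace 1 (max R 0 + 1)).Finite :=
    Set.finite_of_encard_le_coe (hN 1).le
  obtain ⟨S, hS⟩ := (hfin.image fun g => m₂.dist g 1).bddAbove
  refine ⟨S, fun x y hxy => ?_⟩
  have e₁ : m₁.dist (y⁻¹ * x) 1 = m₁.dist x y := by
    have := @dist_smul G G m₁.toPseudoMetricSpace _ h₁ y⁻¹ x y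
    simpa using this
  have e₂ : m₂.dist (y⁻¹ * x) 1 = m₂.dist x y := by
    have := @dist_smul G G m₂.toPseudoMetricSpace _ h₂ y⁻¹ x y
    simpa using this
  rw [← e₂]
  refine hS ⟨y⁻¹ * x, ?_, rfl⟩
  change m₁.dist (y⁻¹ * x) 1 < max R 0 + 1
  rw [e₁]
  linarith [le_max_left R 0]

/-- A group with property A has property A for each of its left-invariant metrics of bounded
geometry. -/
theorem GroupHasPropertyA.hasPropertyA {G : Type*} [Group G] (hG : GroupHasPropertyA G)
    (m : MetricSpace G) (hm : IsIsometricSMul G G) (bm : HasBoundedGeometry G) :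
    HasPropertyA G := by
  obtain ⟨m₁, h₁, b₁, hA⟩ := hG
  intro R ε hR hε
  obtain ⟨R', hR'⟩ := exists_dist_le_of_boundedGeometry m m₁ hm bm h₁ R
  obtain ⟨A, hne, hvar, S, hS⟩ := hA (max R' 1) ε (by positivity) hε
  obtain ⟨S', hS'⟩ := exists_dist_le_of_boundedGeometry m₁ m h₁ b₁ hm S
  exact ⟨A, hne, fun x y h => hvar x y ((hR' x y h).trans (le_max_left _ _)),
    S', fun x y n h => hS' x y (hS x y n h)⟩

/-- The two-element family consisting of `G` (at `true`) and `H` (at `false`). -/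
def AmalgamFactor (G H : Type u) : Bool → Type u
  | true => G
  | false => H

instance AmalgamFactor.group (G H : Type u) [Group G] [Group H] :
    ∀ b, Group (AmalgamFactor G H b)
  | true => inferInstanceAs (Group G)
  | false => inferInstanceAs (Group H)

/-- The pair of homomorphisms `φ : K → G`, `ψ : K → H`, as a family. -/
def amalgamMap {G H : Type u} {K : Type v} [Group G] [Group H] [Group K] (φ : K →* G) (ψ : K →* H) :
    ∀ b, K →* AmalgamFactor G H b
  | true => φ
  | false => ψ

/-- The free product `G ∗_K H` of `G` and `H` with amalgamation along `φ : K → G` and `ψ : K → H`,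
i.e. the pushout of `φ` and `ψ` in the category of groups. -/
abbrev AmalgamatedFreeProduct {G H : Type u} {K : Type v} [Group G] [Group H] [Group K]
    (φ : K →* G) (ψ : K →* H) : Type (max u v) :=
  Monoid.PushoutI (amalgamMap φ ψ)

/-! For a countable group, property A amounts to `HasApproxEquivariantMeans` for the identity: maps
to probability measures on one finite subset, equivariant up to `ε` under finitely many elements. In
this form the property can be assembled from stabilizers
(`exists_approxEquivariant_of_stabilizers`). In the action of the amalgam on its Bass–Serre tree,
the stabilizers of the factor cosets are conjugates of the factors, so it remains to find
approximately equivariant measures on finitely many such vertices.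

The normal form of `x` traces a path of factor cosets. Left multiplication by an element of a factor
carries the path along, up to adding or dropping its first vertex (`wordPath_of_smul`). The uniform
measure on the first `N` vertices is therefore equivariant up to `O(1/N)`. The tree need not be
locally finite, however, so these measures may have no common finite support.

The remedy is to stop each path on leaving a finite set `T i` of an increasing sequence, and to
average over `i < M` (`exists_approxEquivariant_of_paths`). The stay time is monotone in `i` and
lies in `[0, N]`. Hence, for `M` large, it is the same for `T i` and `T (i + 2)` for most `i`, and
for those stopping commutes with translation up to the time shift. -/

/-! ### Averages, and invariant metrics on countable groups -/

/-- Between finite sets, averages of a bounded function are close if the symmetric difference is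
relatively small. -/
theorem abs_average_sub_average_le {α : Type*} [DecidableEq α] (A B : Finset α) (hA : A.Nonempty) (hB : B.Nonempty)
    (g : α → ℝ) (hg : ∀ a, |g a| ≤ 1) :
    |(∑ a ∈ A, g a) / A.card - (∑ a ∈ B, g a) / B.card| ≤
      2 * (symmDiff A B).card / A.card := by
  have hA' : (0 : ℝ) < A.card := by exact_mod_cast hA.card_pos
  have hB' : (0 : ℝ) < B.card := by exact_mod_cast hB.card_pos
  have key : ∀ g : α → ℝ, (∀ a, |g a| ≤ 1) →
      |∑ a ∈ A, g a - ∑ a ∈ B, g a| ≤ (symmDiff A B).card := by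
    intro g hg
    have h1 : ∑ a ∈ A, g a - ∑ a ∈ B, g a = ∑ a ∈ A \ B, g a - ∑ a ∈ B \ A, g a := by
      rw [← Finset.sum_sdiff_sub_sum_sdiff]
    have h2 : (symmDiff A B).card = (A \ B).card + (B \ A).card := by
      rw [symmDiff_def, Finset.sup_eq_union, Finset.card_union_of_disjoint disjoint_sdiff_sdiff]
    have h3 : ∀ C : Finset α, |∑ a ∈ C, g a| ≤ C.card := fun C =>
      (Finset.abs_sum_le_sum_abs _ _).trans
        ((Finset.sum_le_sum fun a _ => hg a).trans (by simp))
    rw [h1, h2]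
    push_cast
    exact (abs_sub _ _).trans (add_le_add (h3 _) (h3 _))
  have hSB : |∑ a ∈ B, g a| ≤ B.card :=
    (Finset.abs_sum_le_sum_abs _ _).trans ((Finset.sum_le_sum fun a _ => hg a).trans (by simp))
  have hc : |(A.card : ℝ) - B.card| ≤ (symmDiff A B).card := by
    simpa using key (fun _ => 1) (by simp)
  have e : (∑ a ∈ A, g a) / A.card - (∑ a ∈ B, g a) / B.card =
      ((∑ a ∈ A, g a - ∑ a ∈ B, g a) - (∑ a ∈ B, g a) / B.card * (A.card - B.card)) / A.card := by
    field_simp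
    ring
  rw [e, abs_div, abs_of_pos hA']
  gcongr
  refine (abs_sub _ _).trans ?_
  rw [abs_mul, abs_div, abs_of_pos hB']
  have : |∑ a ∈ B, g a| / B.card ≤ 1 := by rwa [div_le_one hB']
  nlinarith [key g hg, abs_nonneg ((A.card : ℝ) - B.card),
    mul_le_mul this hc (abs_nonneg _) zero_le_one]

/-- A countable group carries a left-invariant metric of bounded geometry: a word metric for
weighted generators. -/
theorem exists_boundedGeometry_metric (G : Type*) [Group G] [Countable G] :
    ∃ _ : MetricSpace G, IsIsometricSMul G G ∧ HasBoundedGeometry G := by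
  obtain ⟨enc, henc⟩ := exists_injective_nat G
  -- The weight is symmetric and finite-to-one. The `+ 1` bounds the length of a word by its weight,
  -- so only finitely many words have weight at most `n`.
  let w : G → ℕ := fun g => enc g + enc g⁻¹ + 1
  have w_inv : ∀ g, w g⁻¹ = w g := fun g => by simp only [w, inv_inv]; omega
  let W : List G → ℕ := fun l => (l.map w).sum
  have W_append : ∀ l m, W (l ++ m) = W l + W m := fun l m => by simp [W]
  have W_inv : ∀ l : List G, W (l.map (·⁻¹)).reverse = W l := fun l => by
    simp only [W, List.map_reverse, List.sum_reverse, List.map_map, Function.comp_def, w_inv]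
  let len : G → ℕ := fun g => sInf {n | ∃ l : List G, l.prod = g ∧ W l = n}
  have len_le : ∀ l : List G, len l.prod ≤ W l := fun l => Nat.sInf_le ⟨l, rfl, rfl⟩
  have exists_len : ∀ g, ∃ l : List G, l.prod = g ∧ W l = len g := fun g =>
    Nat.sInf_mem (s := {n | ∃ l : List G, l.prod = g ∧ W l = n}) ⟨_, [g], by simp, rfl⟩
  have length_le : ∀ l : List G, l.length ≤ W l := fun l => by
    induction l with
    | nil => simp [W]
    | cons a l ih =>
      simp only [W, List.map_cons, List.sum_cons, List.length_cons] at ih ⊢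
      have : 1 ≤ w a := Nat.le_add_left _ _
      omega
  have len_one : len 1 = 0 := Nat.le_zero.1 (by simpa [W] using len_le [])
  have len_inv_le : ∀ g, len g⁻¹ ≤ len g := fun g => by
    obtain ⟨l, rfl, hl⟩ := exists_len g
    rw [← hl, List.prod_inv_reverse, ← W_inv]
    exact len_le _
  have len_inv : ∀ g, len g⁻¹ = len g := fun g =>
    (len_inv_le g).antisymm (by simpa using len_inv_le g⁻¹)
  have len_mul : ∀ g h, len (g * h) ≤ len g + len h := fun g h => by
    obtain ⟨l, rfl, hl⟩ := exists_len g
    obtain ⟨m, rfl, hm⟩ := exists_len h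
    rw [← hl, ← hm, ← W_append, ← List.prod_append]
    exact len_le _
  have len_finite : ∀ n, {g | len g ≤ n}.Finite := fun n => by
    have h1 : {g | w g ≤ n}.Finite :=
      ((Set.finite_Iic n).preimage henc.injOn).subset fun g hg => by
        simp only [Set.mem_preimage, Set.mem_Iic, Set.mem_ofPred_eq, w] at hg ⊢; omega
    have h2 : {l : List G | (∀ a ∈ l, a ∈ {g | w g ≤ n}) ∧ l.length ≤ n}.Finite := by
      have := h1.to_subtype
      refine ((List.finite_length_le {g | w g ≤ n} n).image
        (List.map Subtype.val)).subset ?_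
      rintro l ⟨hl, hn⟩
      exact ⟨l.pmap Subtype.mk hl, List.length_pmap.trans_le hn, by simp [List.map_pmap]⟩
    refine (h2.image List.prod).subset fun g hg => ?_
    obtain ⟨l, rfl, hl⟩ := exists_len g
    have hW : W l ≤ n := hl.trans_le hg
    refine ⟨l, ⟨fun a ha => ?_, (length_le l).trans hW⟩, rfl⟩
    exact (List.single_le_sum (by simp) _ (List.mem_map_of_mem ha)).trans hW
  let m : MetricSpace G :=
    { dist := fun x y => len (x⁻¹ * y)
      dist_self := fun x => by simp [len_one]
      dist_comm := fun x y => by rw [← len_inv]; simp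
      dist_triangle := fun x y z => by
        have := len_mul (x⁻¹ * y) (y⁻¹ * z)
        rw [show x⁻¹ * y * (y⁻¹ * z) = x⁻¹ * z by group] at this
        exact_mod_cast this
      eq_of_dist_eq_zero := fun {x y} h => by
        have h0 : len (x⁻¹ * y) = 0 := by exact_mod_cast h
        obtain ⟨l, hl, hW⟩ := exists_len (x⁻¹ * y)
        have := length_le l
        have hnil : l = [] := List.length_eq_zero_iff.1 (by omega)
        rw [hnil, List.prod_nil] at hl
        exact (inv_mul_eq_one.1 hl.symm) }
  have dist_eq : ∀ x y : G, dist x y = len (x⁻¹ * y) := fun _ _ => rfl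
  refine ⟨m, ⟨fun g => Isometry.of_dist_eq fun x y => ?_⟩, fun r _ => ?_⟩
  · simp only [dist_eq, smul_eq_mul]
    rw [show (g * x)⁻¹ * (g * y) = x⁻¹ * y by group]
  · refine ⟨{g | len g ≤ ⌈r⌉₊}.ncard + 1, fun x => ?_⟩
    have hsub : Metric.ball x r ⊆ (x * ·) '' {g | len g ≤ ⌈r⌉₊} := fun y hy => by
      refine ⟨x⁻¹ * y, ?_, by simp⟩
      rw [Metric.mem_ball', dist_eq] at hy
      exact_mod_cast hy.le.trans (Nat.le_ceil r)
    refine ((Set.encard_le_encard hsub).trans (Set.encard_image_le _ _)).trans_lt ?_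
    rw [← (len_finite _).cast_ncard_eq]
    exact_mod_cast Nat.lt_succ_self _

/-! ### Property A as approximately equivariant means -/

/-- `F`, on which `Γ` acts by left multiplication along `ι`, has approximately `Γ`-equivariant maps
to the probability measures on a finite part of `Γ`. Closeness of measures is tested on functions
bounded by `1`. -/
def HasApproxEquivariantMeans {Γ F : Type*} [Group Γ] [Group F] (ι : Γ →* F) : Prop :=
  ∀ (E : Finset Γ) (ε : ℝ), 0 < ε → ∃ (S : Finset Γ) (b : F → Γ → ℝ),
    (∀ x s, 0 ≤ b x s) ∧ (∀ x, ∑ s ∈ S, b x s = 1) ∧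
    ∀ e ∈ E, ∀ x, ∀ f : Γ → ℝ, (∀ s, |f s| ≤ 1) →
      |∑ s ∈ S, b (ι e * x) s * f s - ∑ s ∈ S, b x s * f (e * s)| ≤ ε

/-- Translating `A x⁻¹` by `x` moves it over a fixed ball around `1`; counting in fibres gives the
measure at `x`. Equivariance under `e` compares `A (e * x)⁻¹` with `A x⁻¹`, whose base points are at
distance `dist e 1`. -/
theorem GroupHasPropertyA.hasApproxEquivariantMeans {G : Type*} [Group G]
    (hG : GroupHasPropertyA G) : HasApproxEquivariantMeans (MonoidHom.id G) := by
  classical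
  obtain ⟨m, hm, hb, hA⟩ := hG
  intro E ε hε
  obtain ⟨R, hR⟩ := (E.finite_toSet.image fun e : G => dist e 1).bddAbove
  obtain ⟨A, hne, hvar, r, hr⟩ := hA (max R 1) (ε / 2) (by positivity) (by positivity)
  have hfin : (Metric.ball (1 : G) (max r 0 + 1)).Finite := by
    obtain ⟨N, hN⟩ := hb (max r 0 + 1) (by positivity)
    exact Set.finite_of_encard_le_coe (hN 1).le
  have hS : ∀ x : G, ∀ p ∈ A x⁻¹, x * p.1 ∈ hfin.toFinset := fun x p hp => by
    have h := hr x⁻¹ p.1 p.2 hp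
    rw [← dist_mul_left x, mul_inv_cancel, dist_comm] at h
    simp only [Set.Finite.mem_toFinset, Metric.mem_ball]
    linarith [le_max_left r 0]
  have hcard : ∀ x, (0 : ℝ) < (A x).card := fun x => by exact_mod_cast (hne x).card_pos
  have hsum : ∀ (x : G) (f : G → ℝ), ∑ s ∈ hfin.toFinset,
      (((A x⁻¹).filter fun p => x * p.1 = s).card : ℝ) / (A x⁻¹).card * f s =
        (∑ p ∈ A x⁻¹, f (x * p.1)) / (A x⁻¹).card := fun x f => by
    rw [← Finset.sum_fiberwise_of_maps_to (hS x), Finset.sum_div]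
    refine Finset.sum_congr rfl fun s _ => ?_
    rw [Finset.sum_congr rfl (g := fun _ => f s) fun p hp => by rw [(Finset.mem_filter.1 hp).2]]
    rw [Finset.sum_const, nsmul_eq_mul]
    ring
  refine ⟨hfin.toFinset, fun x s => (((A x⁻¹).filter fun p => x * p.1 = s).card : ℝ) /
    (A x⁻¹).card, fun x s => by positivity, fun x => ?_, fun e he x f hf => ?_⟩
  · have := hsum x fun _ => 1
    simp only [mul_one, Finset.sum_const, nsmul_eq_mul] at this
    rw [this, div_self (hcard _).ne']
  · have h2 := hsum x fun s => f (e * s)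
    simp only [MonoidHom.id_apply] at *
    rw [hsum, h2]
    simp only [mul_assoc]
    refine (abs_average_sub_average_le (A (e * x)⁻¹) (A x⁻¹) (hne _) (hne _)
      (fun p => f (e * (x * p.1))) fun p => hf _).trans ?_
    rw [div_le_iff₀ (hcard _)]
    have hd : dist (e * x)⁻¹ x⁻¹ ≤ max R 1 := by
      rw [← dist_mul_left (e * x)]
      simp only [mul_inv_cancel, mul_inv_cancel_right]
      rw [dist_comm]
      exact (hR ⟨e, he, rfl⟩).trans (le_max_left _ _)
    have h3 := hvar _ _ hd
    have h4 : ((A (e * x)⁻¹ ∩ A x⁻¹).card : ℝ) ≤ (A (e * x)⁻¹).card := by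
      exact_mod_cast Finset.card_le_card Finset.inter_subset_left
    have h5 := mul_le_mul_of_nonneg_left h4 (half_pos hε).le
    linarith

/-- Restriction to a subgroup: a group acts freely on any overgroup. -/
theorem HasApproxEquivariantMeans.along {G F : Type*} [Group G] [Group F]
    (h : HasApproxEquivariantMeans (MonoidHom.id G)) (ι : G →* F) (hι : Function.Injective ι) :
    HasApproxEquivariantMeans ι := by
  -- Representatives `r x` of the right cosets of `ι.range` give `x = ι (π x) * r x`, with `π`
  -- equivariant; the means are pulled back along `π`.
  have : ∃ π : F → G, ∀ g x, π (ι g * x) = g * π x := by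
    let r : F → F := fun x => (Quotient.mk (QuotientGroup.rightRel ι.range) x).out
    have hr : ∀ g x, r (ι g * x) = r x := fun g x => by
      refine congrArg Quotient.out (Quotient.sound ?_)
      rw [← Quotient.eq_iff_equiv, Quotient.eq, QuotientGroup.rightRel_apply]
      exact ⟨g⁻¹, by simp⟩
    have hx : ∀ x, ∃ g, ι g = x * (r x)⁻¹ := fun x => by
      have := Quotient.exact (Quotient.out_eq (Quotient.mk (QuotientGroup.rightRel ι.range) x))
      exact QuotientGroup.rightRel_apply.1 this
    choose π hπ using hx
    refine ⟨π, fun g x => hι ?_⟩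
    rw [hπ, hr, map_mul, hπ, mul_assoc]
  obtain ⟨π, hπ⟩ := this
  intro E ε hε
  obtain ⟨S, b, hb0, hb1, hb⟩ := h E ε hε
  refine ⟨S, fun x => b (π x), fun x => hb0 _, fun x => hb1 _, fun e he x f hf => ?_⟩
  simp only [hπ]
  exact hb e he (π x) f hf

/-- The region under the graph of `u : X → ℕ` over a finite set. -/
theorem exists_region {X : Type*} (S : Finset X) (u : X → ℕ) :
    ∃ A : Finset (X × ℕ), (∀ p, p ∈ A ↔ p.1 ∈ S ∧ p.2 < u p.1) ∧ A.card = ∑ x ∈ S, u x :=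
  ⟨(S.sigma fun x => Finset.range (u x)).map (Equiv.sigmaEquivProd X ℕ).toEmbedding,
    fun p => by simp [Finset.mem_map_equiv, Equiv.sigmaEquivProd], by simp⟩

/-- Weights that nearly agree give, after scaling and rounding, finite subsets of `X × ℕ` that
nearly agree. -/
theorem card_symmDiff_lt_of_weights {X : Type*} [DecidableEq X] (T : Finset X) (p q : X → ℝ) (hp : ∀ x, 0 ≤ p x)
    (hq : ∀ x, 0 ≤ q x) (hp1 : ∑ x ∈ T, p x = 1) {ε Q : ℝ} (hε : 0 < ε)
    (hε1 : ε ≤ 1) (hQ : 0 < Q) (hT : T.card ≤ Q * (ε / 8)) (h : ∑ x ∈ T, |p x - q x| ≤ ε / 8)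
    (A B : Finset (X × ℕ)) (hA : ∀ z, z ∈ A ↔ z.1 ∈ T ∧ z.2 < ⌊Q * p z.1⌋₊)
    (hB : ∀ z, z ∈ B ↔ z.1 ∈ T ∧ z.2 < ⌊Q * q z.1⌋₊) :
    ((symmDiff A B).card : ℝ) < ε * (A ∩ B).card := by
  set u : X → ℕ := fun x => ⌊Q * p x⌋₊
  set v : X → ℕ := fun x => ⌊Q * q x⌋₊
  obtain ⟨C, hC, hCc⟩ := exists_region T fun x => min (u x) (v x)
  obtain ⟨D, hD, hDc⟩ := exists_region T fun x => max (u x) (v x)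
  have eC : A ∩ B = C := by
    ext z; simp only [Finset.mem_inter, hA, hB, hC, u, v, lt_min_iff]; tauto
  have eD : A ∪ B = D := by
    ext z; simp only [Finset.mem_union, hA, hB, hD, u, v, lt_max_iff]; tauto
  have hsd : ((symmDiff A B).card : ℝ) = D.card - C.card := by
    rw [symmDiff_eq_sup_sdiff_inf, Finset.sup_eq_union, Finset.inf_eq_inter, eC, eD,
      Finset.card_sdiff_of_subset, Nat.cast_sub]
    · exact Finset.card_le_card (eC ▸ eD ▸ Finset.inter_subset_union)
    · exact eC ▸ eD ▸ Finset.inter_subset_union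
  have hpt : ∀ x, ((max (u x) (v x) : ℕ) : ℝ) - (min (u x) (v x) : ℕ) ≤ Q * |p x - q x| + 1 ∧
      Q * p x - (Q * |p x - q x| + 1) ≤ (min (u x) (v x) : ℕ) := fun x => by
    have a1 := Nat.floor_le (mul_nonneg hQ.le (hp x))
    have a2 := Nat.lt_floor_add_one (Q * p x)
    have b1 := Nat.floor_le (mul_nonneg hQ.le (hq x))
    have b2 := Nat.lt_floor_add_one (Q * q x)
    have c1 := mul_le_mul_of_nonneg_left (le_abs_self (p x - q x)) hQ.le
    have c2 := mul_le_mul_of_nonneg_left (neg_abs_le (p x - q x)) hQ.le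
    change (u x : ℝ) ≤ _ at a1
    change _ < (u x : ℝ) + 1 at a2
    change (v x : ℝ) ≤ _ at b1
    change _ < (v x : ℝ) + 1 at b2
    rcases le_total (u x) (v x) with huv | huv
    · rw [max_eq_right huv, min_eq_left huv]
      constructor <;> linarith
    · rw [max_eq_left huv, min_eq_right huv]
      constructor <;> linarith
  -- Rounding costs at most `1` per point of `T`, so the symmetric difference has at most `Q * ε /
  -- 4` points, while the intersection has at least `Q / 2`.
  have hs1 : (D.card : ℝ) - C.card ≤ Q * (ε / 8) + T.card := by
    rw [hCc, hDc]
    push_cast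
    rw [← Finset.sum_sub_distrib]
    refine (Finset.sum_le_sum fun x _ => by exact_mod_cast (hpt x).1).trans ?_
    rw [Finset.sum_add_distrib, ← Finset.mul_sum]
    simpa using mul_le_mul_of_nonneg_left h hQ.le
  have hs2 : Q - (Q * (ε / 8) + T.card) ≤ (C.card : ℝ) := by
    rw [hCc]
    push_cast
    refine le_trans ?_ (Finset.sum_le_sum fun x _ => by exact_mod_cast (hpt x).2)
    rw [Finset.sum_sub_distrib, Finset.sum_add_distrib, ← Finset.mul_sum, ← Finset.mul_sum, hp1]
    have := mul_le_mul_of_nonneg_left h hQ.le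
    simp only [Finset.sum_const, nsmul_eq_mul, mul_one]
    linarith
  rw [hsd, eC]
  have hQε : 0 < Q * ε := by positivity
  have hQε' : Q * ε ≤ Q := by nlinarith
  have : Q / 2 ≤ (C.card : ℝ) := by linarith
  nlinarith

/-- The mean at `x⁻¹`, translated by `x`, is a measure `p x` supported near `x`. Nearby points have
`ℓ¹`-close measures, and scaling and rounding turns these into finite sets. -/
theorem HasApproxEquivariantMeans.groupHasPropertyA {F : Type*} [Group F] [Countable F]
    (h : HasApproxEquivariantMeans (MonoidHom.id F)) : GroupHasPropertyA F := by
  classical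
  obtain ⟨m, hm, hb⟩ := exists_boundedGeometry_metric F
  refine ⟨m, hm, hb, fun R ε' hR hε' => ?_⟩
  obtain ⟨ε, hε, hε1, hεε⟩ : ∃ ε : ℝ, 0 < ε ∧ ε ≤ 1 ∧ ε ≤ ε' :=
    ⟨min ε' 1, by positivity, min_le_right _ _, min_le_left _ _⟩
  have hfin : (Metric.ball (1 : F) (R + 1)).Finite := by
    obtain ⟨N, hN⟩ := hb (R + 1) (by positivity)
    exact Set.finite_of_encard_le_coe (hN 1).le
  obtain ⟨S, b, hb0, hb1, hbE⟩ := h hfin.toFinset (ε / 8) (by positivity)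
  have hSne : S.Nonempty := Finset.nonempty_of_sum_ne_zero (by rw [hb1 1]; exact one_ne_zero)
  -- Two translates of `S` have at most `2 * S.card = Q * (ε / 8)` points together.
  set Q : ℝ := 2 * S.card * 8 / ε with hQdef
  have hScard : (0 : ℝ) < S.card := by exact_mod_cast hSne.card_pos
  have hQ : 0 < Q := by positivity
  have hQS : 2 * (S.card : ℝ) = Q * (ε / 8) := by rw [hQdef]; field_simp
  set p : F → F → ℝ := fun x z => if x⁻¹ * z ∈ S then b x⁻¹ (x⁻¹ * z) else 0 with hp
  have hp0 : ∀ x z, 0 ≤ p x z := fun x z => by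
    simp only [hp]; split_ifs; exacts [hb0 _ _, le_rfl]
  have hpsum : ∀ (x : F) (T : Finset F) (f : F → ℝ), S.image (x * ·) ⊆ T →
      ∑ z ∈ T, p x z * f z = ∑ s ∈ S, b x⁻¹ s * f (x * s) := fun x T f hT => by
    rw [← Finset.sum_subset hT, Finset.sum_image fun a _ b _ => mul_left_cancel]
    · refine Finset.sum_congr rfl fun s hs => ?_
      simp [hp, hs]
    · intro z _ hz
      have : x⁻¹ * z ∉ S := fun h => hz (Finset.mem_image.2 ⟨_, h, by simp⟩)
      simp [hp, this]
  have hp1 : ∀ (x : F) (T : Finset F), S.image (x * ·) ⊆ T → ∑ z ∈ T, p x z = 1 :=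
    fun x T hT => by simpa [hb1] using hpsum x T (fun _ => 1) hT
  choose A hA hAc using fun x => exists_region (S.image (x * ·)) fun z => ⌊Q * p x z⌋₊
  have hA' : ∀ (x : F) (T : Finset F), S.image (x * ·) ⊆ T →
      ∀ z, z ∈ A x ↔ z.1 ∈ T ∧ z.2 < ⌊Q * p x z.1⌋₊ := fun x T hT z => by
    rw [hA]
    refine ⟨fun h => ⟨hT h.1, h.2⟩, fun h => ⟨?_, h.2⟩⟩
    by_contra hz
    have : x⁻¹ * z.1 ∉ S := fun h => hz (Finset.mem_image.2 ⟨_, h, by simp⟩)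
    have h2 := h.2
    simp [hp, this] at h2
  have hvar : ∀ x y : F, dist x y ≤ R →
      ((symmDiff (A x) (A y)).card : ℝ) < ε * (A x ∩ A y).card := by
    intro x y hxy
    set T := S.image (x * ·) ∪ S.image (y * ·) with hT
    have hTx : S.image (x * ·) ⊆ T := Finset.subset_union_left
    have hTy : S.image (y * ·) ⊆ T := Finset.subset_union_right
    refine card_symmDiff_lt_of_weights T (p x) (p y) (hp0 x) (hp0 y) (hp1 x T hTx) hε hε1 hQ ?_ ?_ _ _ (hA' x T hTx) (hA' y T hTy)
    · rw [← hQS]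
      have := (Finset.card_union_le (S.image (x * ·)) (S.image (y * ·))).trans
        (add_le_add Finset.card_image_le Finset.card_image_le)
      rw [two_mul]
      exact_mod_cast this
    -- Testing against this sign function turns the estimate for bounded functions into the
    -- `ℓ¹`-distance.
    · set f : F → ℝ := fun z => SignType.sign (p y z - p x z) with hf
      have hf1 : ∀ z, |f z| ≤ 1 := fun z => by
        simp only [hf]
        rcases SignType.trichotomy (SignType.sign (p y z - p x z)) with h | h | h <;> simp [h]
      have hmem : y⁻¹ * x ∈ hfin.toFinset := by
        rw [Set.Finite.mem_toFinset, Metric.mem_ball, ← dist_mul_left y, mul_one, mul_inv_cancel_left]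
        linarith
      have := hbE _ hmem x⁻¹ (fun s => f (y * s)) fun s => hf1 _
      simp only [MonoidHom.id_apply, mul_assoc, mul_inv_cancel, mul_one, mul_inv_cancel_left] at this
      rw [← hpsum y T f hTy, ← hpsum x T f hTx, ← Finset.sum_sub_distrib] at this
      refine le_trans (le_of_eq ?_) ((le_abs_self _).trans this)
      refine Finset.sum_congr rfl fun z _ => ?_
      rw [← sub_mul, abs_sub_comm, hf, self_mul_sign]
  refine ⟨A, fun x => ?_, fun x y hxy => (hvar x y hxy).trans_le ?_, ?_⟩
  -- For `x = y` the strict inequality reads `0 < ε * (A x).card`.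
  · have := hvar x x (by simpa using hR.le)
    rw [symmDiff_self, Finset.inter_self, Finset.bot_eq_empty, Finset.card_empty, Nat.cast_zero] at this
    exact Finset.card_pos.1 (by exact_mod_cast pos_of_mul_pos_right this hε.le)
  · exact mul_le_mul_of_nonneg_right hεε (Nat.cast_nonneg _)
  · obtain ⟨r, hr⟩ := (S.finite_toSet.image fun s : F => dist 1 s).bddAbove
    refine ⟨r, fun x y n hy => ?_⟩
    obtain ⟨s, hs, rfl⟩ := Finset.mem_image.1 ((hA x _).1 hy).1
    have := hr ⟨s, hs, rfl⟩
    simp only at this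
    rwa [← dist_mul_left x, mul_one] at this

/-! ### Occupation measures of stopped paths -/

/-- The last time, at most `N`, up to which the path `p` stays in `T`. -/
noncomputable def stayTime {V : Type*} (N : ℕ) (T : Finset V) (p : ℕ → V) : ℕ :=
  @Nat.findGreatest (fun n => ∀ m ≤ n, p m ∈ T) (Classical.decPred _) N

section StayTime

variable {V : Type*} {N : ℕ} {T T' : Finset V} {p : ℕ → V}

theorem stayTime_le : stayTime N T p ≤ N := by
  let := Classical.decPred fun n => ∀ m ≤ n, p m ∈ T
  exact Nat.findGreatest_le N

theorem mem_of_le_stayTime (h : p 0 ∈ T) {m : ℕ} (hm : m ≤ stayTime N T p) : p m ∈ T := by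
  let := Classical.decPred fun n => ∀ m ≤ n, p m ∈ T
  exact Nat.findGreatest_spec (P := fun n => ∀ m ≤ n, p m ∈ T) (Nat.zero_le N)
    (fun m hm => by rwa [Nat.le_zero.1 hm]) m hm

theorem le_stayTime {n : ℕ} (hn : n ≤ N) (h : ∀ m ≤ n, p m ∈ T) : n ≤ stayTime N T p := by
  let := Classical.decPred fun n => ∀ m ≤ n, p m ∈ T
  exact Nat.le_findGreatest (P := fun n => ∀ m ≤ n, p m ∈ T) hn h

theorem stayTime_mono (h : T ⊆ T') : stayTime N T p ≤ stayTime N T' p := by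
  let := Classical.decPred fun n => ∀ m ≤ n, p m ∈ T
  let := Classical.decPred fun n => ∀ m ≤ n, p m ∈ T'
  exact Nat.findGreatest_mono_left (P := fun n => ∀ m ≤ n, p m ∈ T)
    (Q := fun n => ∀ m ≤ n, p m ∈ T') (fun n hn m hm => h (hn m hm)) N

/-- Two paths that agree up to a map `ρ` and a time shift by at most `1`, stopped on leaving `T₁`,
have close occupation measures, unless the stay time of the first depends on the choice of the set
between `T₀` and `T₂`. -/
theorem abs_sum_stopped_sub_le {p' : ℕ → V} {T₀ T₁ T₂ : Finset V} (ρ : V → V) (h₀₁ : T₀ ⊆ T₁)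
    (h₁₂ : T₁ ⊆ T₂) (hρ : ∀ v ∈ T₀, ρ v ∈ T₁) (hρ' : ∀ v, ρ v ∈ T₁ → v ∈ T₂) {k : ℕ} (hk : k ≤ 1)
    (hp : ∀ n, p' (n + k) = ρ (p n)) (h0 : p 0 ∈ T₀) (h0' : p' 0 ∈ T₁) (f : V → ℝ)
    (hf : ∀ v, |f v| ≤ 1) :
    |∑ n ∈ Finset.range N, f (p' (min n (stayTime N T₁ p'))) -
      ∑ n ∈ Finset.range N, f (ρ (p (min n (stayTime N T₁ p))))| ≤
      2 + 2 * N * ((stayTime N T₂ p : ℝ) - stayTime N T₀ p) := by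
  have m₀₁ := stayTime_mono (N := N) (p := p) h₀₁
  have m₁₂ := stayTime_mono (N := N) (p := p) h₁₂
  have two : ∀ v w, |f v - f w| ≤ 2 := fun v w =>
    (abs_sub _ _).trans (by linarith [hf v, hf w])
  -- If the stay times agree, `p` leaves all three sets at the same time and `p'` leaves `T₁` with
  -- the shift `k`, up to the cutoff `N`; at most one term on each side is unmatched. Otherwise they
  -- differ by at least `1`, and the trivial bound `2 * N` suffices.
  by_cases heq : stayTime N T₀ p = stayTime N T₂ p
  · have e₁ : stayTime N T₁ p = stayTime N T₂ p := m₁₂.antisymm (heq ▸ m₀₁)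
    have lower : min N (stayTime N T₁ p + k) ≤ stayTime N T₁ p' := by
      refine le_stayTime (min_le_left _ _) fun m hm => ?_
      rcases lt_or_ge m k with hmk | hmk
      · obtain rfl : m = 0 := by omega
        exact h0'
      · obtain ⟨n, rfl⟩ := Nat.exists_eq_add_of_le' hmk
        rw [hp]
        refine hρ _ (mem_of_le_stayTime (N := N) h0 ?_)
        have := hm.trans (min_le_right _ _)
        omega
    have upper : stayTime N T₁ p' ≤ stayTime N T₁ p + k := by
      by_contra! hlt
      have : stayTime N T₁ p' - k ≤ stayTime N T₂ p := by
        refine le_stayTime ((Nat.sub_le _ _).trans stayTime_le) fun m hm => hρ' _ ?_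
        rw [← hp]
        exact mem_of_le_stayTime (N := N) h0' (by omega)
      omega
    rw [heq, sub_self, mul_zero, add_zero]
    set ℓ := stayTime N T₁ p
    set ℓ' := stayTime N T₁ p'
    have hℓ : ∀ n, n + k < N → p' (min (n + k) ℓ') = ρ (p (min n ℓ)) := fun n hn => by
      rw [← hp]
      congr 1
      omega
    obtain rfl | rfl : k = 0 ∨ k = 1 := by omega
    · simp only [add_zero] at hℓ
      rw [Finset.sum_congr rfl fun n hn => congrArg f (hℓ n (Finset.mem_range.1 hn)), sub_self,
        abs_zero]
      exact zero_le_two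
    · rcases N with _ | N
      · simp
      · rw [Finset.sum_range_succ', Finset.sum_range_succ,
          Finset.sum_congr rfl fun n hn =>
            congrArg f (hℓ n (Nat.succ_lt_succ (Finset.mem_range.1 hn))), add_sub_add_left_eq_sub]
        exact two _ _
  · have hlt : (stayTime N T₀ p : ℝ) + 1 ≤ stayTime N T₂ p := by
      exact_mod_cast lt_of_le_of_ne (m₀₁.trans m₁₂) heq
    rw [← Finset.sum_sub_distrib]
    have h1 := (Finset.abs_sum_le_sum_abs (fun n => f (p' (min n (stayTime N T₁ p'))) -
      f (ρ (p (min n (stayTime N T₁ p))))) (Finset.range N)).trans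
        (Finset.sum_le_sum fun n _ => two _ _)
    simp only [Finset.sum_const, Finset.card_range, nsmul_eq_mul] at h1
    have h2 : (N : ℝ) * 1 ≤ N * ((stayTime N T₂ p : ℝ) - stayTime N T₀ p) :=
      mul_le_mul_of_nonneg_left (by linarith) (Nat.cast_nonneg N)
    linarith

end StayTime

/-- If paths `p x` in an `F`-set are equivariant up to time shifts, then there are approximately
equivariant probability measures on finitely many vertices: the occupation measures of the paths,
stopped on leaving one of finitely many finite sets. -/
theorem exists_approxEquivariant_of_paths {F V : Type*} [Group F] [MulAction F V] (p : F → ℕ → V)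
    (V₀ : Finset V) (hp : ∀ x, p x 0 ∈ V₀) (E : Finset F)
    (hE : ∀ e ∈ E, ∀ x, (∀ n, p (e * x) n = e • p x n) ∨ (∀ n, p (e * x) (n + 1) = e • p x n) ∨
      ∀ n, p (e * x) n = e • p x (n + 1)) {ε : ℝ} (hε : 0 < ε) :
    ∃ (S : Finset V) (ζ : F → V → ℝ), (∀ x v, 0 ≤ ζ x v) ∧ (∀ x, ∑ v ∈ S, ζ x v = 1) ∧
      ∀ e ∈ E, ∀ x, ∀ f : V → ℝ, (∀ v, |f v| ≤ 1) →
        |∑ v ∈ S, ζ (e * x) v * f v - ∑ v ∈ S, ζ x v * f (e • v)| ≤ ε := by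
  classical
  obtain ⟨T, T_zero, T_succ⟩ : ∃ T : ℕ → Finset V, T 0 = V₀ ∧ ∀ i, T (i + 1) = T i ∪
      ((E ×ˢ T i).image (fun q => q.1 • q.2) ∪ (E ×ˢ T i).image (fun q => q.1⁻¹ • q.2)) :=
    ⟨fun i => Nat.rec V₀ (fun _ T => T ∪ ((E ×ˢ T).image (fun q => q.1 • q.2) ∪
      (E ×ˢ T).image (fun q => q.1⁻¹ • q.2))) i, rfl, fun _ => rfl⟩
  have T_mono : Monotone T := monotone_nat_of_le_succ fun i => by
    rw [T_succ]; exact Finset.subset_union_left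
  have hpT : ∀ x i, p x 0 ∈ T i := fun x i => T_mono (Nat.zero_le i) (T_zero ▸ hp x)
  have T_smul : ∀ g : F, (g ∈ E ∨ g⁻¹ ∈ E) → ∀ i, ∀ v ∈ T i, g • v ∈ T (i + 1) := by
    intro g hg i v hv
    rw [T_succ, Finset.mem_union, Finset.mem_union]
    rcases hg with hg | hg
    · exact .inr (.inl (Finset.mem_image.2 ⟨(g, v), Finset.mk_mem_product hg hv, rfl⟩))
    · exact .inr (.inr (Finset.mem_image.2 ⟨(g⁻¹, v), Finset.mk_mem_product hg hv, by simp⟩))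
  -- The total error is at most `2 * M + 2 * N * (2 * N)`; the choices of `N` and `M` make each
  -- summand at most half of `ε * (M * N)`.
  obtain ⟨N, hN⟩ := exists_nat_ge (4 / ε)
  have hN0 : (0 : ℝ) < N := lt_of_lt_of_le (by positivity) hN
  obtain ⟨M, hM⟩ := exists_nat_ge (8 * N / ε)
  have hM0 : (0 : ℝ) < M := lt_of_lt_of_le (by positivity) hM
  rw [div_le_iff₀ hε] at hN hM
  let q : F → ℕ × ℕ → V := fun x a => p x (min a.2 (stayTime N (T (a.1 + 1)) (p x)))
  let I : Finset (ℕ × ℕ) := Finset.range M ×ˢ Finset.range N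
  have main : ∀ (x y g : F), (g ∈ E ∨ g⁻¹ ∈ E) → ∀ k ≤ 1, (∀ n, p y (n + k) = g • p x n) →
      ∀ f : V → ℝ, (∀ v, |f v| ≤ 1) →
        |∑ a ∈ I, f (q y a) - ∑ a ∈ I, f (g • q x a)| ≤ ε * (M * N) := by
    intro x y g hg k hk hxy f hf
    have hg' : g⁻¹ ∈ E ∨ g⁻¹⁻¹ ∈ E := by rwa [inv_inv, or_comm]
    simp only [I, q, Finset.sum_product]
    rw [← Finset.sum_sub_distrib]
    refine (Finset.abs_sum_le_sum_abs _ _).trans ((Finset.sum_le_sum fun i _ =>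
      abs_sum_stopped_sub_le (N := N) (T₀ := T i) (T₁ := T (i + 1)) (T₂ := T (i + 2)) (g • ·)
        (T_mono (by omega)) (T_mono (by omega)) (T_smul g hg i)
        (fun v hv => by simpa using T_smul g⁻¹ hg' _ _ hv) hk hxy (hpT _ _) (hpT _ _) f hf).trans ?_)
    rw [Finset.sum_add_distrib, ← Finset.mul_sum]
    -- A difference over two steps is the sum of two one-step differences, each of which telescopes
    -- to at most `N`.
    have tele : ∑ i ∈ Finset.range M, ((stayTime N (T (i + 2)) (p x) : ℝ) - stayTime N (T i) (p x)) ≤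
        2 * N := by
      have h1 := Finset.sum_range_sub (fun i => (stayTime N (T i) (p x) : ℝ)) M
      have h2 := Finset.sum_range_sub (fun i => (stayTime N (T (i + 1)) (p x) : ℝ)) M
      have h3 : ∀ i, (stayTime N (T i) (p x) : ℝ) ≤ N := fun i => by exact_mod_cast stayTime_le
      have h4 : ∀ i, (0 : ℝ) ≤ stayTime N (T i) (p x) := fun i => Nat.cast_nonneg _
      have h5 := congrArg₂ (· + ·) h1 h2
      simp only [← Finset.sum_add_distrib] at h5
      rw [Finset.sum_congr rfl fun i _ => show _ = (stayTime N (T (i + 2)) (p x) : ℝ) -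
        stayTime N (T i) (p x) by simp only [add_assoc, Nat.reduceAdd]; ring] at h5
      rw [h5]
      linarith [h3 M, h3 (M + 1), h4 0, h4 (0 + 1)]
    have t2 := mul_le_mul_of_nonneg_left tele (by positivity : (0 : ℝ) ≤ 2 * N)
    have t3 := mul_le_mul_of_nonneg_right hN hM0.le
    have t4 := mul_le_mul_of_nonneg_right hM hN0.le
    simp only [Finset.sum_const, Finset.card_range, nsmul_eq_mul]
    linarith
  have hq : ∀ x, ∀ a ∈ I, q x a ∈ T M := fun x a ha => by
    have ha1 : a.1 + 1 ≤ M := Finset.mem_range.1 (Finset.mem_product.1 ha).1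
    exact T_mono ha1 (mem_of_le_stayTime (N := N) (hpT _ _) (min_le_right _ _))
  have hsum : ∀ (x : F) (f : V → ℝ), ∑ v ∈ T M,
      ((I.filter fun a => q x a = v).card : ℝ) / (M * N) * f v =
        (∑ a ∈ I, f (q x a)) / (M * N) := fun x f => by
    rw [← Finset.sum_fiberwise_of_maps_to (hq x), Finset.sum_div]
    refine Finset.sum_congr rfl fun v _ => ?_
    rw [Finset.sum_congr rfl (g := fun _ => f v) fun a ha => by rw [(Finset.mem_filter.1 ha).2]]
    rw [Finset.sum_const, nsmul_eq_mul]
    ring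
  refine ⟨T M, fun x v => ((I.filter fun a => q x a = v).card : ℝ) / (M * N),
    fun x v => by positivity, fun x => ?_, fun e he x f hf => ?_⟩
  · have := hsum x fun _ => 1
    simp only [mul_one] at this
    rw [this, Finset.sum_const, nsmul_eq_mul, mul_one, Finset.card_product, Finset.card_range,
      Finset.card_range]
    push_cast
    exact div_self (by positivity)
  · have h2 := hsum x fun v => f (e • v)
    rw [hsum, h2, ← sub_div, abs_div, abs_of_pos (by positivity : (0 : ℝ) < M * N),
      div_le_iff₀ (by positivity)]
    rcases hE e he x with h | h | h
    · exact main x (e * x) e (.inl he) 0 zero_le_one h f hf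
    · exact main x (e * x) e (.inl he) 1 le_rfl h f hf
    · have := main (e * x) x e⁻¹ (.inr (by rwa [inv_inv])) 1 le_rfl
        (fun n => by rw [h, inv_smul_smul]) (fun v => f (e • v)) fun v => hf _
      rw [abs_sub_comm]
      simpa only [smul_inv_smul] using this

/-! ### Induction from stabilizers and reduction to generators -/

/-- A group that acts with approximately equivariant probability measures on finitely many points
inherits approximately equivariant means from finitely many stabilizers: here `v : V` has stabilizer
`σ v • ι (τ v) (Γ (τ v))`, for a section `σ` of the orbit maps. -/
theorem exists_approxEquivariant_of_stabilizers {F V B : Type*} {Γ : B → Type*} [Group F]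
    [MulAction F V] [∀ b, Group (Γ b)] (ι : ∀ b, Γ b →* F) (hι : ∀ b, Function.Injective (ι b))
    (hΓ : ∀ b, HasApproxEquivariantMeans (ι b)) (τ : V → B) (hτ : ∀ (g : F) v, τ (g • v) = τ v)
    (σ : V → F) (hσ : ∀ (g : F) v, ∃ c : Γ (τ v), g * σ v = σ (g • v) * ι (τ v) c) (E : Finset F)
    (hE : ∀ ε : ℝ, 0 < ε → ∃ (S : Finset V) (ζ : F → V → ℝ), (∀ x v, 0 ≤ ζ x v) ∧
      (∀ x, ∑ v ∈ S, ζ x v = 1) ∧ ∀ e ∈ E, ∀ x, ∀ f : V → ℝ, (∀ v, |f v| ≤ 1) →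
        |∑ v ∈ S, ζ (e * x) v * f v - ∑ v ∈ S, ζ x v * f (e • v)| ≤ ε) {ε : ℝ} (hε : 0 < ε) :
    ∃ (S : Finset F) (b : F → F → ℝ), (∀ x s, 0 ≤ b x s) ∧ (∀ x, ∑ s ∈ S, b x s = 1) ∧
      ∀ e ∈ E, ∀ x, ∀ f : F → ℝ, (∀ s, |f s| ≤ 1) →
        |∑ s ∈ S, b (e * x) s * f s - ∑ s ∈ S, b x s * f (e * s)| ≤ ε := by
  classical
  obtain ⟨S, ζ, hζ0, hζ1, hζ⟩ := hE (ε / 2) (half_pos hε)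
  -- With `S` fixed, only finitely many cocycle values `c` in `e * σ v = σ (e • v) * ι c` occur, so
  -- the means on the stabilizers can be chosen afterwards.
  have hfin : ∀ b, {c : Γ b | ∃ e ∈ E, ∃ v ∈ S, (σ (e • v))⁻¹ * (e * σ v) = ι b c}.Finite := by
    intro b
    refine (((E ×ˢ S).image fun q => (σ (q.1 • q.2))⁻¹ * (q.1 * σ q.2)).finite_toSet.preimage
      (hι b).injOn).subset ?_
    rintro c ⟨e, he, v, hv, h⟩
    exact Finset.mem_coe.2 (Finset.mem_image.2 ⟨(e, v), Finset.mk_mem_product he hv, h⟩)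
  choose R β hβ0 hβ1 hβ using fun b => hΓ b (hfin b).toFinset (ε / 2) (half_pos hε)
  let Φ : B → F → (F → ℝ) → ℝ := fun b y h => ∑ t ∈ R b, β b y t * h (ι b t)
  have hΦ : ∀ b y h, (∀ s, |h s| ≤ 1) → |Φ b y h| ≤ 1 := fun b y h hh => by
    refine (Finset.abs_sum_le_sum_abs _ _).trans ?_
    rw [← hβ1 b y]
    refine Finset.sum_le_sum fun t _ => ?_
    rw [abs_mul, abs_of_nonneg (hβ0 b y t)]
    exact mul_le_of_le_one_right (hβ0 b y t) (hh _)
  let U : Finset F := S.biUnion fun v => (R (τ v)).image fun t => σ v * ι (τ v) t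
  -- The mean at `x` mixes, with weights `ζ x v`, the stabilizer means at `(σ v)⁻¹ * x` translated
  -- by `σ v`.
  let w : F → F → ℝ := fun x s => ∑ v ∈ S, ∑ t ∈ R (τ v),
    if s = σ v * ι (τ v) t then ζ x v * β (τ v) ((σ v)⁻¹ * x) t else 0
  have hw : ∀ (x : F) (f : F → ℝ), ∑ s ∈ U, w x s * f s =
      ∑ v ∈ S, ζ x v * Φ (τ v) ((σ v)⁻¹ * x) fun z => f (σ v * z) := by
    intro x f
    simp only [w, Finset.sum_mul]
    rw [Finset.sum_comm]
    refine Finset.sum_congr rfl fun v hv => ?_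
    rw [Finset.sum_comm, Finset.mul_sum]
    refine Finset.sum_congr rfl fun t ht => ?_
    have hU : σ v * ι (τ v) t ∈ U :=
      Finset.mem_biUnion.2 ⟨v, hv, Finset.mem_image.2 ⟨t, ht, rfl⟩⟩
    simp only [ite_mul, zero_mul]
    rw [Finset.sum_ite_eq' , if_pos hU, mul_assoc]
  refine ⟨U, w, fun x s => Finset.sum_nonneg fun v _ => Finset.sum_nonneg fun t _ => ?_,
    fun x => ?_, fun e he x f hf => ?_⟩
  · split_ifs
    exacts [mul_nonneg (hζ0 _ _) (hβ0 _ _ _), le_rfl]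
  · have := hw x fun _ => 1
    simpa [Φ, hβ1, hζ1] using this
  · have h2 := hw x fun s => f (e * s)
    rw [hw, h2]
    have h3 := hζ e he x (fun v => Φ (τ v) ((σ v)⁻¹ * (e * x)) fun z => f (σ v * z))
      fun v => hΦ _ _ _ fun s => hf _
    have h4 : |∑ v ∈ S, ζ x v * (Φ (τ (e • v)) ((σ (e • v))⁻¹ * (e * x)) fun z => f (σ (e • v) * z)) -
        ∑ v ∈ S, ζ x v * Φ (τ v) ((σ v)⁻¹ * x) fun z => f (e * (σ v * z))| ≤ ε / 2 := by
      rw [← Finset.sum_sub_distrib]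
      refine (Finset.abs_sum_le_sum_abs _ _).trans ?_
      calc _ ≤ ∑ v ∈ S, ζ x v * (ε / 2) := Finset.sum_le_sum fun v hv => ?_
        _ = ε / 2 := by rw [← Finset.sum_mul, hζ1, one_mul]
      rw [← mul_sub, abs_mul, abs_of_nonneg (hζ0 x v), hτ]
      refine mul_le_mul_of_nonneg_left ?_ (hζ0 x v)
      obtain ⟨c, hc⟩ := hσ e v
      have hc' : (σ (e • v))⁻¹ * (e * σ v) = ι (τ v) c := by rw [hc, inv_mul_cancel_left]
      have h5 := hβ (τ v) c ((hfin _).mem_toFinset.2 ⟨e, he, v, hv, hc'⟩) ((σ v)⁻¹ * x)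
        (fun t => f (σ (e • v) * ι (τ v) t)) fun t => hf _
      have e1 : ι (τ v) c * ((σ v)⁻¹ * x) = (σ (e • v))⁻¹ * (e * x) := by
        rw [← hc']; group
      have e2 : ∀ t, σ (e • v) * ι (τ v) (c * t) = e * (σ v * ι (τ v) t) := fun t => by
        rw [map_mul, ← mul_assoc, ← hc, mul_assoc]
      simpa only [e1, e2] using h5
    refine (abs_sub_le _ _ _).trans ((add_le_add h3 h4).trans (add_halves ε).le)

/-- Approximate equivariance need only be checked for the elements of a generating set. -/
theorem hasApproxEquivariantMeans_of_closure_eq_top {F : Type*} [Group F] {X : Set F}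
    (hX : Submonoid.closure X = ⊤)
    (h : ∀ E : Finset F, (E : Set F) ⊆ X → ∀ ε : ℝ, 0 < ε →
      ∃ (S : Finset F) (b : F → F → ℝ), (∀ x s, 0 ≤ b x s) ∧ (∀ x, ∑ s ∈ S, b x s = 1) ∧
        ∀ e ∈ E, ∀ x, ∀ f : F → ℝ, (∀ s, |f s| ≤ 1) →
          |∑ s ∈ S, b (e * x) s * f s - ∑ s ∈ S, b x s * f (e * s)| ≤ ε) :
    HasApproxEquivariantMeans (MonoidHom.id F) := by
  classical
  let P : Finset F → (F → F → ℝ) → ℝ → F → Prop := fun S b ε e =>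
    ∀ x, ∀ f : F → ℝ, (∀ s, |f s| ≤ 1) →
      |∑ s ∈ S, b (e * x) s * f s - ∑ s ∈ S, b x s * f (e * s)| ≤ ε
  -- Errors add along a product of generators; `D` and `L` depend only on `e`, so the tolerance can
  -- be fixed before the means.
  have key : ∀ e ∈ Submonoid.closure X, ∃ (D : Finset F) (L : ℕ), (D : Set F) ⊆ X ∧
      ∀ S b ε, (∀ d ∈ D, P S b ε d) → P S b (L * ε) e := by
    intro e he
    induction he using Submonoid.closure_induction with
    | mem x hx => exact ⟨{x}, 1, by simpa using hx, fun S b ε h => by simpa using h⟩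
    | one => exact ⟨∅, 0, by simp, fun S b ε h x f hf => by simp⟩
    | mul g₁ g₂ _ _ h₁ h₂ =>
      obtain ⟨D₁, L₁, hD₁, h₁⟩ := h₁
      obtain ⟨D₂, L₂, hD₂, h₂⟩ := h₂
      refine ⟨D₁ ∪ D₂, L₁ + L₂, by simp [hD₁, hD₂], fun S b ε h x f hf => ?_⟩
      have a₁ := h₁ S b ε (fun d hd => h d (Finset.mem_union_left _ hd)) (g₂ * x) f hf
      have a₂ := h₂ S b ε (fun d hd => h d (Finset.mem_union_right _ hd)) x
        (fun s => f (g₁ * s)) fun s => hf _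
      simp only [mul_assoc]
      push_cast
      rw [add_mul]
      exact (abs_sub_le _ _ _).trans (add_le_add a₁ a₂)
  choose D L hD hP using fun e => key e (hX ▸ Submonoid.mem_top e)
  intro E ε hε
  obtain ⟨S, b, hb0, hb1, hb⟩ := h (E.biUnion D) (by simpa using fun e _ => hD e)
    (ε / (∑ e ∈ E, L e + 1 : ℕ)) (by positivity)
  refine ⟨S, b, hb0, hb1, fun e he x f hf => ?_⟩
  refine (hP e S b _ (fun d hd => hb d (Finset.mem_biUnion.2 ⟨e, he, hd⟩)) x f hf).trans ?_
  have hL : L e ≤ ∑ e ∈ E, L e + 1 :=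
    (Finset.single_le_sum (fun _ _ => Nat.zero_le _) he).trans (Nat.le_succ _)
  have hL' : (L e : ℝ) ≤ (∑ e ∈ E, L e + 1 : ℕ) := by exact_mod_cast hL
  have hpos : (0 : ℝ) < (∑ e ∈ E, L e + 1 : ℕ) := by positivity
  rw [mul_div_assoc', div_le_iff₀ hpos, mul_comm ε]
  exact mul_le_mul_of_nonneg_right hL' hε.le

/-! ### Normal-form paths in the Bass–Serre tree -/

namespace Monoid.PushoutI

variable {ι : Type*} {G : ι → Type*} {K : Type*} [∀ i, Group (G i)] [Group K] (φ : ∀ i, K →* G i)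

/-- The vertices of the Bass–Serre tree of an amalgamated product that are cosets of a factor. -/
abbrev FactorCosets : Type _ := Σ i, PushoutI φ ⧸ (of (φ := φ) i).range

variable {φ}

/-- The vertex that is the factor `i`. -/
def factorVertex (i : ι) : FactorCosets φ := ⟨i, (1 : PushoutI φ)⟩

theorem of_smul_factorVertex (i : ι) (g : G i) :
    of (φ := φ) i g • factorVertex (φ := φ) i = factorVertex i := by
  refine congrArg (Sigma.mk i) ?_
  refine (QuotientGroup.eq (s := (of (φ := φ) i).range)).2 ⟨g⁻¹, ?_⟩
  simp

/-- The path along the factor cosets that are passed on the way from the base edge to the vertex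
`l.prod • factorVertex i₀`. -/
noncomputable def letterPath (i₀ : ι) : List (Σ i, G i) → ℕ → FactorCosets φ
  | [] => fun _ => factorVertex i₀
  | l :: ls => fun n => Nat.casesOn n (factorVertex l.1) fun n =>
      of (φ := φ) l.1 l.2 • letterPath i₀ ls n

theorem letterPath_zero_mem (i₀ : ι) (l : List (Σ i, G i)) :
    ∃ i, letterPath (φ := φ) i₀ l 0 = factorVertex i := by
  cases l with
  | nil => exact ⟨i₀, rfl⟩
  | cons a l => exact ⟨a.1, rfl⟩

variable {d : NormalWord.Transversal φ}

/-- The path along the factor cosets that belongs to a normal word. -/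
noncomputable def wordPath (i₀ : ι) (w : NormalWord d) (n : ℕ) : FactorCosets φ :=
  base φ w.head • letterPath i₀ w.toList n

theorem wordPath_zero_mem (i₀ : ι) (w : NormalWord d) :
    ∃ i, wordPath i₀ w 0 = factorVertex i := by
  obtain ⟨i, hi⟩ := letterPath_zero_mem (φ := φ) i₀ w.toList
  exact ⟨i, by rw [wordPath, hi, ← of_apply_eq_base φ i, of_smul_factorVertex]⟩

variable [DecidableEq ι] [∀ i, DecidableEq (G i)]

open NormalWord in
-- The normal form splits `p.head` into an element of `K` and a transversal letter. That letter is
-- trivial, hence absent from the word, exactly when `p.head` lies in the image of `K`.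
theorem wordPath_rcons (i₀ i : ι) (p : NormalWord.Pair d i) :
    (p.head ∈ (φ i).range → ∀ n, wordPath i₀ (rcons i p) n =
      of (φ := φ) i p.head • letterPath i₀ p.tail.toList n) ∧
    (p.head ∉ (φ i).range → wordPath i₀ (rcons i p) 0 = factorVertex i ∧ ∀ n,
      wordPath i₀ (rcons i p) (n + 1) = of (φ := φ) i p.head • letterPath i₀ p.tail.toList n) := by
  have hsnd := Subgroup.IsComplement.coe_equiv_snd_eq_one_iff_mem (d.compl i) (d.one_mem i)
    (g := p.head)
  have hmul := Subgroup.IsComplement.equiv_fst_mul_equiv_snd (d.compl i) p.head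
  have hbase : base φ (rcons i p).head = of (φ := φ) i ((d.compl i).equiv p.head).1 := by
    rw [← of_apply_eq_base φ i]
    exact congrArg _ (MonoidHom.apply_ofInjective_symm (d.injective i) _)
  have hlist : (rcons i p).toList =
      (CoprodI.Word.rcons (M := G) (i := i)
        { p.toPair with head := (((d.compl i).equiv p.head).2 : G i) }).toList := rfl
  constructor
  · intro h n
    have h1 := hsnd.2 h
    rw [wordPath, hbase, hlist, CoprodI.Word.rcons, dif_pos h1]
    rw [h1, mul_one] at hmul
    rw [hmul]
  · intro h
    have h1 := mt hsnd.1 h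
    have hl : (rcons i p).toList = ⟨i, ((d.compl i).equiv p.head).2⟩ :: p.tail.toList := by
      rw [hlist, CoprodI.Word.rcons, dif_neg h1]
      rfl
    constructor
    · rw [wordPath, hbase, hl]
      exact of_smul_factorVertex i _
    · intro n
      rw [wordPath, hbase, hl]
      change _ • _ • _ = _
      rw [smul_smul, ← map_mul, hmul]

/-- Multiplication by `g` only changes the head of the pair. The path gains or loses its first
vertex when the head leaves or enters the image of `K`; otherwise there is no time shift. -/
theorem wordPath_of_smul (i₀ i : ι) (g : G i) (w : NormalWord d) :
    (∀ n, wordPath i₀ (of (φ := φ) i g • w) n = of (φ := φ) i g • wordPath i₀ w n) ∨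
    (∀ n, wordPath i₀ (of (φ := φ) i g • w) (n + 1) = of (φ := φ) i g • wordPath i₀ w n) ∨
    ∀ n, wordPath i₀ (of (φ := φ) i g • w) n = of (φ := φ) i g • wordPath i₀ w (n + 1) := by
  set p := NormalWord.equivPair i w with hp
  have hw : w = NormalWord.rcons i p := ((NormalWord.equivPair i).symm_apply_apply w).symm
  have hgw : of (φ := φ) i g • w = NormalWord.rcons i { p with head := g * p.head } :=
    NormalWord.summand_smul_def g w
  obtain ⟨a₁, a₂⟩ := wordPath_rcons i₀ i p
  obtain ⟨b₁, b₂⟩ := wordPath_rcons i₀ i { p with head := g * p.head }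
  rw [hgw, hw]
  simp only [map_mul, mul_smul] at b₁ b₂
  by_cases h₁ : p.head ∈ (φ i).range <;> by_cases h₂ : g * p.head ∈ (φ i).range
  · exact .inl fun n => by rw [b₁ h₂, a₁ h₁]
  · exact .inr (.inl fun n => by rw [(b₂ h₂).2, a₁ h₁])
  · exact .inr (.inr fun n => by rw [b₁ h₂, (a₂ h₁).2])
  · refine .inl fun n => ?_
    cases n with
    -- Both paths start at the vertex of factor `i`, which `g` fixes.
    | zero => rw [(b₂ h₂).1, (a₂ h₁).1, of_smul_factorVertex]
    | succ n => rw [(b₂ h₂).2, (a₂ h₁).2]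

end Monoid.PushoutI

/-! ### Property A of amalgamated products -/

open Monoid PushoutI

theorem Monoid.PushoutI.countable {ι K : Type*} {G : ι → Type*} [∀ i, Group (G i)] [Group K]
    [Countable ι] [∀ i, Countable (G i)] [Countable K] (φ : ∀ i, K →* G i)
    (hφ : ∀ i, Function.Injective (φ i)) : Countable (PushoutI φ) := by
  classical
  obtain ⟨d⟩ := NormalWord.transversal_nonempty φ hφ
  have : Function.Injective fun w : NormalWord d => (w.head, w.toList) := fun w w' h =>
    NormalWord.ext (Prod.ext_iff.1 h).1 (Prod.ext_iff.1 h).2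
  have := this.countable
  exact NormalWord.equiv (d := d).injective.countable

/-- The amalgamated product of a finite family of groups with property A has property A. -/
theorem Monoid.PushoutI.groupHasPropertyA {ι K : Type*} {G : ι → Type*} [∀ i, Group (G i)] [Group K]
    [Finite ι] [Nonempty ι] [∀ i, Countable (G i)] (φ : ∀ i, K →* G i)
    (hφ : ∀ i, Function.Injective (φ i)) (hG : ∀ i, GroupHasPropertyA (G i)) :
    GroupHasPropertyA (PushoutI φ) := by
  classical
  have := Fintype.ofFinite ι
  obtain ⟨i₀⟩ := ‹Nonempty ι›
  obtain ⟨d⟩ := NormalWord.transversal_nonempty φ hφ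
  have : Countable K := (hφ i₀).countable
  have : Countable (PushoutI φ) := Monoid.PushoutI.countable φ hφ
  have hof := of_injective hφ
  let X : Set (PushoutI φ) := ⋃ i, Set.range (of (φ := φ) i)
  have hXof : ∀ i (g : G i), of (φ := φ) i g ∈ X := fun i g => Set.mem_iUnion.2 ⟨i, g, rfl⟩
  have hX : Submonoid.closure X = ⊤ := by
    refine eq_top_iff.2 fun x _ => ?_
    induction x using PushoutI.induction_on with
    | of i g => exact Submonoid.subset_closure (hXof i g)
    | base h => exact of_apply_eq_base φ i₀ h ▸ Submonoid.subset_closure (hXof i₀ _)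
    | mul x y hx hy => exact mul_mem (hx trivial) (hy trivial)
  refine (hasApproxEquivariantMeans_of_closure_eq_top hX fun E hE ε hε => ?_).groupHasPropertyA
  refine exists_approxEquivariant_of_stabilizers (V := FactorCosets φ) (fun i => of (φ := φ) i) hof
    (fun i => (hG i).hasApproxEquivariantMeans.along _ (hof i)) Sigma.fst (fun _ _ => rfl)
    (fun v => v.2.out) (fun g v => ?_) E (fun δ hδ => ?_) hε
  · have h : ((g * v.2.out : PushoutI φ) : PushoutI φ ⧸ (of (φ := φ) v.1).range) =
        ((g • v).2.out : PushoutI φ) :=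
      (congrArg (g • ·) (QuotientGroup.out_eq' v.2)).trans (QuotientGroup.out_eq' (g • v).2).symm
    obtain ⟨c, hc⟩ := QuotientGroup.eq.1 h.symm
    exact ⟨c, by rw [hc, mul_inv_cancel_left]⟩
  · refine exists_approxEquivariant_of_paths
      (fun x => wordPath i₀ (x • (NormalWord.empty : NormalWord d)))
      (Finset.univ.image factorVertex) (fun x => ?_) E (fun e he x => ?_) hδ
    · obtain ⟨i, hi⟩ := wordPath_zero_mem i₀ (x • (NormalWord.empty : NormalWord d))
      exact Finset.mem_image.2 ⟨i, Finset.mem_univ i, hi.symm⟩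
    · obtain ⟨i, g, rfl⟩ := Set.mem_iUnion.1 (hE he)
      simp only [mul_smul]
      exact wordPath_of_smul i₀ i g _

theorem mainTheorem6 {G H : Type u} {K : Type v} [Group G] [Group H] [Group K] [Countable G] [Countable H]
    (φ : K →* G) (ψ : K →* H) (hφ : Function.Injective φ) (hψ : Function.Injective ψ)
    (hG : GroupHasPropertyA G) (hH : GroupHasPropertyA H) :
    GroupHasPropertyA (AmalgamatedFreeProduct φ ψ) := by
  have : ∀ b, Countable (AmalgamFactor G H b) := by
    rintro (_ | _)
    exacts [‹Countable H›, ‹Countable G›]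
  refine Monoid.PushoutI.groupHasPropertyA (amalgamMap φ ψ) ?_ ?_
  · rintro (_ | _)
    exacts [hψ, hφ]
  · rintro (_ | _)
    exacts [hH, hG]
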